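/- Work in the universe $V$ of sets; formulas are first-order formulas in the language $\{\in\}$. A formula $\phi(x_1,\dots,x_n)$ is absolute for a set $M$ if for all $a_1,\dots,a_n\in M$ we have $\phi^M(a_1,\dots,a_n)\Leftrightarrow\phi(a_1,\dots,a_n)$, where $\phi^M$ arises from $\phi$ by restricting all quantifiers to $M$. For a finite list of formulas $\phi_1,\dots,\phi_n$ and a countable set $Y$, write $M\prec(\phi_1,\dots,\phi_n;Y)$ if $M$ is a countable set, $M\supset Y$, and each of $\phi_1,\dots,\phi_n$ is absolute for $M$. A set-valued map $\varphi$ from a topological space $\Sigma$ to a Banach space $X$ is called usc-K (with respect to the weak topology $w$) if $\varphi(s)$ is a nonempty weakly compact subset of $X$ for every $s\in\Sigma$ and $\{s\in\Sigma:\varphi(s)\subset U\}$ is open for every weakly open $U\subset X$; it is onto $X$ if $\bigcup_{s\in\Sigma}\varphi(s)=X$. **Proposition.** There are a finite list of formulas $\phi_1,\dots,\phi_n$ and a countable set $Y$ such that for every $M\prec(\phi_1,\dots,\phi_n;Y)$ the following holds. Let $X$ be a real or complex Banach space, $\Sigma$ a separable metric space and $\varphi:\Sigma\to(X,w)$ a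 usc-K map which is onto $X$. If $X,\Sigma,\varphi\in M$ (where $X$ stands for the tuple $(X,+,\cdot,\|\cdot\|)$, $\Sigma$ for the pair $(\Sigma,d)$ of the space and its metric, and $\varphi$ for a map from $\Sigma$ to the power set of $X$), then $$\overline{X\cap M}+(X^*\cap M)_\perp=X,$$ where the closure is in the norm, $X^*$ is the set of continuous linear functionals on $X$, and $D_\perp=\{x\in X: f(x)=0\text{ for all }f\in D\}$ for $D\subset X^*$. -/

import Mathlib

open scoped Pointwise

universe u

noncomputable section

namespace SetModel

/-! ### The language of set theory, absoluteness, elementary models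

The universe of sets is Mathlib's `ZFSet`; formulas are Mathlib's first-order formulas
in the language whose only non-logical symbol is the binary relation symbol `∈`. -/

/-- The relation symbols of the language of set theory. -/
inductive SetRel : ℕ → Type
  | mem : SetRel 2

/-- The first-order language of set theory. -/
def setLang : FirstOrder.Language.{0, 0} := ⟨fun _ => Empty, SetRel⟩

/-- The symbol `∈`. -/
abbrev memSym : setLang.Relations 2 := SetRel.mem

/-- The universe of all sets, with the true membership relation. -/
instance univStructure : setLang.Structure ZFSet.{u} where
  funMap f := f.elim
  RelMap r := match r with
    | SetRel.mem => fun x => x 0 ∈ x 1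

/-- A collection `M` of sets, with the true membership relation. The quantifiers of a formula
realized in this structure range over `M`, so realization in it is truth of the
relativization of the formula to `M`. -/
instance subStructure (M : Set ZFSet.{u}) : setLang.Structure M where
  funMap f := f.elim
  RelMap r := match r with
    | SetRel.mem => fun x => (x 0 : ZFSet.{u}) ∈ (x 1 : ZFSet.{u})

/-- `φ` is absolute for `M`: for parameters in `M`, the relativization of `φ` to `M` holds
if and only if `φ` holds. -/
def Absolute (φ : setLang.Formula ℕ) (M : Set ZFSet.{u}) : Prop :=
  ∀ a : ℕ → M, φ.Realize a ↔ φ.Realize (fun i => (a i : ZFSet.{u}))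

/-- `M ≺ (Φ; Y)`: `M` is a countable set containing `Y` as a subset, and every formula of the
finite list `Φ` is absolute for `M`. -/
structure IsElementaryModel (Φ : List (setLang.Formula ℕ)) (Y M : Set ZFSet.{u}) : Prop where
  countable : M.Countable
  subset : Y ⊆ M
  absolute : ∀ φ ∈ Φ, Absolute φ M

/-! ### Numbers and maps as sets -/

/-- Natural numbers as von Neumann ordinals. -/
def natCode : ℕ → ZFSet.{u}
  | 0 => ∅
  | n + 1 => insert (natCode n) (natCode n)

/-- The integer `z` as the pair of its positive and its negative part. -/
def intCode (z : ℤ) : ZFSet.{u} := ZFSet.pair (natCode z.toNat) (natCode (-z).toNat)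

/-- Rational numbers as pairs (numerator, denominator) in lowest terms. -/
def ratCode (q : ℚ) : ZFSet.{u} := ZFSet.pair (intCode q.num) (natCode q.den)

/-- Real numbers as Dedekind cuts, i.e. `r` is the set of all rationals below it. -/
def realCode (r : ℝ) : ZFSet.{u} := ZFSet.range fun q : {q : ℚ // (q : ℝ) < r} => ratCode q.1

/-- Complex numbers as pairs (real part, imaginary part). -/
def complexCode (z : ℂ) : ZFSet.{u} := ZFSet.pair (realCode z.re) (realCode z.im)

open Classical in
/-- The set representing a scalar: a real number for the real field (the case `I = 0` of
`RCLike`), and a complex number for the complex field. -/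
def scalarCode {𝕜 : Type} [RCLike 𝕜] (z : 𝕜) : ZFSet.{u} :=
  if (RCLike.I : 𝕜) = 0 then realCode (RCLike.re z)
  else complexCode ⟨RCLike.re z, RCLike.im z⟩

theorem scalarCode_real (r : ℝ) : scalarCode.{u} r = realCode r := by
  simp [scalarCode]

theorem scalarCode_complex (z : ℂ) : scalarCode.{u} z = complexCode z := by
  simp [scalarCode]

/-- The subset `A` of the set `X`, as a set. -/
def subsetCode {X : ZFSet.{u}} (A : Set X) : ZFSet.{u} :=
  ZFSet.range fun a : A => (a.1 : ZFSet.{u})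

/-- The graph (a set of ordered pairs) of a map `f`, where the arguments and the values of `f`
are represented by sets by means of `i` and `j`. -/
def graphCode {α β : Type*} [Small.{u} α] (i : α → ZFSet.{u}) (j : β → ZFSet.{u}) (f : α → β) :
    ZFSet.{u} :=
  ZFSet.range fun a : α => ZFSet.pair (i a) (j (f a))

/-- The normed space on the set `X`, as the tuple `(X, +, ·, ‖ ‖)`. -/
def normedSpaceCode (𝕜 : Type) [RCLike 𝕜] (X : ZFSet.{u}) [NormedAddCommGroup X]
    [NormedSpace 𝕜 X] : ZFSet.{u} :=
  ZFSet.pair X <|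
    ZFSet.pair (graphCode (fun p : X × X => ZFSet.pair p.1 p.2) (fun x : X => (x : ZFSet.{u}))
      (fun p => p.1 + p.2)) <|
    ZFSet.pair (graphCode (fun p : 𝕜 × X => ZFSet.pair (scalarCode p.1) p.2)
      (fun x : X => (x : ZFSet.{u})) (fun p => p.1 • p.2)) <|
    graphCode (fun x : X => (x : ZFSet.{u})) realCode (fun x : X => ‖x‖)

/-- The metric space on the set `S`, as the pair `(S, d)`. -/
def metricSpaceCode (S : ZFSet.{u}) [MetricSpace S] : ZFSet.{u} :=
  ZFSet.pair S <|
    graphCode (fun p : S × S => ZFSet.pair p.1 p.2) realCode (fun p => dist p.1 p.2)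

/-- A set-valued map from `S` to `X`, as a map (set of pairs) from `S` to the power set of `X`. -/
def multimapCode {S X : ZFSet.{u}} (φ : S → Set X) : ZFSet.{u} :=
  graphCode (fun s : S => (s : ZFSet.{u})) subsetCode φ

/-- A continuous linear functional on `X`, as a map (set of pairs) from `X` to the scalars. -/
def functionalCode {𝕜 : Type} [RCLike 𝕜] {X : ZFSet.{u}} [NormedAddCommGroup X]
    [NormedSpace 𝕜 X] (f : StrongDual 𝕜 X) : ZFSet.{u} :=
  graphCode (fun x : X => (x : ZFSet.{u})) scalarCode f

/-- `X ∩ M`, as a subset of `X`. -/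
def trace (X : ZFSet.{u}) (M : Set ZFSet.{u}) : Set X := {x | (x : ZFSet.{u}) ∈ M}

/-- `X* ∩ M`, as a subset of the dual space `X*`. -/
def dualTrace (𝕜 : Type) [RCLike 𝕜] (X : ZFSet.{u}) [NormedAddCommGroup X] [NormedSpace 𝕜 X]
    (M : Set ZFSet.{u}) : Set (StrongDual 𝕜 X) := {f | functionalCode f ∈ M}

end SetModel

/-- `D_⊥`, the set of common zeros of the functionals in `D`. -/
def preAnnihilator {𝕜 E : Type*} [RCLike 𝕜] [NormedAddCommGroup E] [NormedSpace 𝕜 E]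
    (D : Set (StrongDual 𝕜 E)) : Set E := {x | ∀ f ∈ D, f x = 0}

/-- A set-valued map `φ` from `S` to `(E, w)` is usc-K: its values are nonempty and weakly
compact, and `{s | φ s ⊆ U}` is open for every weakly open `U`. -/
structure IsUscK (𝕜 : Type*) {S E : Type*} [RCLike 𝕜] [TopologicalSpace S]
    [NormedAddCommGroup E] [NormedSpace 𝕜 E] (φ : S → Set E) : Prop where
  nonempty : ∀ s, (φ s).Nonempty
  isCompact : ∀ s, IsCompact (toWeakSpace 𝕜 E '' φ s)
  isOpen : ∀ U : Set (WeakSpace 𝕜 E), IsOpen U → IsOpen {s | toWeakSpace 𝕜 E '' φ s ⊆ U}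

end

namespace SetModel

open FirstOrder Language

/-! ### Formulas -/

/-! Given `x ∈ φ s`, it suffices to find `y` in the norm closure of `X ∩ M` with `f y = f x` for all
`f ∈ X* ∩ M`; then `x = y + (x - y)` is the decomposition. Neither `s` nor `x` need belong to `M`,
but both can be approximated by data that do: `S ∩ M` is dense in `S`, and each `f x` has small
neighbourhoods in `M`, namely rational intervals or squares. For a finite set of functionals in `M`,
the pair `(s, x)` witnesses an existential statement with parameters in `M`, so absoluteness yields
a point of `X ∩ M` lying in a value of `φ` close to `s`, with nearly the same functional values as
`x` (`IsRich.exists_approx`).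

Upper semicontinuity and weak compactness of `φ s` give these approximants a common weak cluster
point `y` (`IsUscK.exists_mem_closure`). It agrees with `x` on `X* ∩ M`. Since `X ∩ M` is closed
under midpoints, its norm closure is convex, hence weakly closed, and contains `y`. -/

/-- Existential quantification over the variable `0`; the remaining variables are shifted. -/
noncomputable def exZero (ψ : setLang.Formula ℕ) : setLang.Formula ℕ :=
  (ψ.relabel (fun n => Nat.casesOn n (Sum.inr ()) Sum.inl : ℕ → ℕ ⊕ Unit)).iExs Unit

/-- The assignment with first value `x`, followed by the values of `v`. -/
def consVal {N : Type*} (x : N) (v : ℕ → N) : ℕ → N := fun n => Nat.casesOn n x v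

theorem realize_exZero {N : Type*} [setLang.Structure N] (ψ : setLang.Formula ℕ) (v : ℕ → N) :
    (exZero ψ).Realize v ↔ ∃ x, ψ.Realize (consVal x v) := by
  have key : ∀ i : Unit → N, (Sum.elim v i) ∘
      (fun n => Nat.casesOn n (Sum.inr ()) Sum.inl : ℕ → ℕ ⊕ Unit) = consVal (i ()) v := by
    intro i
    funext n
    cases n <;> rfl
  simp only [exZero, Formula.realize_iExs, Formula.realize_relabel, key]
  exact ⟨fun ⟨i, hi⟩ => ⟨i (), hi⟩, fun ⟨x, hx⟩ => ⟨fun _ => x, hx⟩⟩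

/-- The Tarski–Vaught argument for a single formula. -/
theorem exists_mem_of_absolute {M : Set ZFSet.{u}} {ψ : setLang.Formula ℕ}
    (hψ : Absolute ψ M) (hex : Absolute (exZero ψ) M) (a : ℕ → M)
    (h : ∃ x, ψ.Realize (consVal x fun i => (a i : ZFSet.{u}))) :
    ∃ x ∈ M, ψ.Realize (consVal x fun i => (a i : ZFSet.{u})) := by
  -- Absoluteness of the existential formula brings existence down to `M`; absoluteness of `ψ` then
  -- makes the witness found there a true one.
  obtain ⟨x, hx⟩ := (realize_exZero ψ a).1 ((hex a).2 ((realize_exZero ψ _).2 h))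
  refine ⟨x, x.2, ?_⟩
  have := (hψ _).1 hx
  convert this using 1
  funext n
  cases n <;> rfl

/-- A relation between sets is expressible if it is given by a first-order formula. -/
def IsExpressible {α : Type} (P : (α → ZFSet.{u}) → Prop) : Prop :=
  ∃ ψ : setLang.Formula α, ∀ v, ψ.Realize v ↔ P v

namespace IsExpressible

variable {α : Type} {P Q : (α → ZFSet.{u}) → Prop}

theorem mem (a b : α) : IsExpressible.{u} fun v => v a ∈ v b :=
  ⟨memSym.formula₂ (Term.var a) (Term.var b), fun v => by
    rw [Formula.realize_rel₂]; rfl⟩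

theorem eq (a b : α) : IsExpressible.{u} fun v => v a = v b :=
  ⟨(Term.var a).equal (Term.var b), fun v => by simp [Formula.realize_equal]⟩

theorem not (hP : IsExpressible P) : IsExpressible fun v => ¬ P v := by
  obtain ⟨ψ, hψ⟩ := hP
  exact ⟨ψ.not, fun v => by rw [Formula.realize_not, hψ]⟩

theorem and (hP : IsExpressible P) (hQ : IsExpressible Q) : IsExpressible fun v => P v ∧ Q v := by
  obtain ⟨ψ, hψ⟩ := hP
  obtain ⟨χ, hχ⟩ := hQ
  exact ⟨ψ ⊓ χ, fun v => by rw [Formula.realize_inf, hψ, hχ]⟩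

theorem or (hP : IsExpressible P) (hQ : IsExpressible Q) : IsExpressible fun v => P v ∨ Q v := by
  obtain ⟨ψ, hψ⟩ := hP
  obtain ⟨χ, hχ⟩ := hQ
  exact ⟨ψ ⊔ χ, fun v => by rw [Formula.realize_sup, hψ, hχ]⟩

theorem imp (hP : IsExpressible P) (hQ : IsExpressible Q) : IsExpressible fun v => P v → Q v := by
  obtain ⟨ψ, hψ⟩ := hP
  obtain ⟨χ, hχ⟩ := hQ
  exact ⟨ψ.imp χ, fun v => by rw [Formula.realize_imp, hψ, hχ]⟩

theorem iff (hP : IsExpressible P) (hQ : IsExpressible Q) :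
    IsExpressible fun v => (P v ↔ Q v) := by
  obtain ⟨ψ, hψ⟩ := hP
  obtain ⟨χ, hχ⟩ := hQ
  exact ⟨ψ.iff χ, fun v => by rw [Formula.realize_iff, hψ, hχ]⟩

/-- Allowing any variable type lets nested quantifiers stack copies of `⊕ Unit`, with the innermost
bound variable as `Sum.inr ()`. -/
theorem ex {R : (α → ZFSet.{u}) → ZFSet.{u} → Prop}
    (hR : IsExpressible fun v : α ⊕ Unit → ZFSet.{u} =>
      R (fun i => v (Sum.inl i)) (v (Sum.inr ()))) :
    IsExpressible fun v => ∃ x, R v x := by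
  obtain ⟨ψ, hψ⟩ := hR
  refine ⟨ψ.iExs Unit, fun v => ?_⟩
  simp only [Formula.realize_iExs, hψ, Sum.elim_inl, Sum.elim_inr]
  exact ⟨fun ⟨i, hi⟩ => ⟨i (), hi⟩, fun ⟨x, hx⟩ => ⟨fun _ => x, hx⟩⟩

theorem all {R : (α → ZFSet.{u}) → ZFSet.{u} → Prop}
    (hR : IsExpressible fun v : α ⊕ Unit → ZFSet.{u} =>
      R (fun i => v (Sum.inl i)) (v (Sum.inr ()))) :
    IsExpressible fun v => ∀ x, R v x := by
  obtain ⟨ψ, hψ⟩ := (ex (R := fun v x => ¬ R v x) hR.not).not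
  exact ⟨ψ, fun v => by simp [hψ]⟩

theorem eq_insert (a b c : α) : IsExpressible.{u} fun v => v a = insert (v b) (v c) := by
  have : IsExpressible.{u} fun v => ∀ w, w ∈ v a ↔ w = v b ∨ w ∈ v c :=
    all (iff (mem _ _) (or (eq _ _) (mem _ _)))
  simpa only [ZFSet.ext_iff, ZFSet.mem_insert_iff] using this

theorem eq_singleton (a b : α) : IsExpressible.{u} fun v => v a = {v b} := by
  have : IsExpressible.{u} fun v => ∀ w, w ∈ v a ↔ w = v b :=
    all (iff (mem _ _) (eq _ _))
  simpa only [ZFSet.ext_iff, ZFSet.mem_singleton] using this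

theorem eq_doubleton (a b c : α) : IsExpressible.{u} fun v => v a = {v b, v c} := by
  have : IsExpressible.{u} fun v => ∀ w, w ∈ v a ↔ w = v b ∨ w = v c :=
    all (iff (mem _ _) (or (eq _ _) (eq _ _)))
  simpa only [ZFSet.ext_iff, ZFSet.mem_pair] using this

theorem eq_pair (a b c : α) : IsExpressible.{u} fun v => v a = ZFSet.pair (v b) (v c) := by
  have : IsExpressible.{u} fun v =>
      ∃ s, ∃ d, (s = {v b} ∧ d = {v b, v c}) ∧ v a = {s, d} :=
    ex (ex (and (and (eq_singleton _ _) (eq_doubleton _ _ _)) (eq_doubleton _ _ _)))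
  simpa [ZFSet.pair, and_assoc] using this

theorem pair_mem (a b c : α) : IsExpressible.{u} fun v => ZFSet.pair (v a) (v b) ∈ v c := by
  have : IsExpressible.{u} fun v => ∃ p, p = ZFSet.pair (v a) (v b) ∧ p ∈ v c :=
    ex (and (eq_pair _ _ _) (mem _ _))
  simpa using this

theorem triple_mem (a b c d : α) :
    IsExpressible.{u} fun v => ZFSet.pair (ZFSet.pair (v a) (v b)) (v c) ∈ v d := by
  have : IsExpressible.{u} fun v => ∃ p, p = ZFSet.pair (v a) (v b) ∧ ZFSet.pair p (v c) ∈ v d :=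
    ex (and (eq_pair _ _ _) (pair_mem _ _ _))
  simpa using this

end IsExpressible

/-- The model `M` contains a witness for the relation `P` (whose variable `0` is the witness)
whenever the parameters are in `M` and a witness exists. -/
def HasWitnesses (M : Set ZFSet.{u}) (P : (ℕ → ZFSet.{u}) → Prop) : Prop :=
  ∀ v : ℕ → ZFSet.{u}, (∀ i, v i ∈ M) → (∃ x, P (consVal x v)) → ∃ x ∈ M, P (consVal x v)

/-- For finitely many expressible relations there is a finite list of formulas whose absoluteness
provides witnesses for all of them. -/
theorem exists_list_hasWitnesses (Ps : List ((ℕ → ZFSet.{u}) → Prop))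
    (h : ∀ P ∈ Ps, IsExpressible P) :
    ∃ Φ : List (setLang.Formula ℕ), ∀ M : Set ZFSet.{u}, (∀ φ ∈ Φ, Absolute φ M) →
      ∀ P ∈ Ps, HasWitnesses M P := by
  induction Ps with
  | nil => exact ⟨[], by simp⟩
  | cons P Ps ih =>
    obtain ⟨Φ, hΦ⟩ := ih fun Q hQ => h Q (List.mem_cons_of_mem _ hQ)
    obtain ⟨ψ, hψ⟩ := h P List.mem_cons_self
    refine ⟨ψ :: exZero ψ :: Φ, fun M hM Q hQ => ?_⟩
    rcases List.mem_cons.1 hQ with rfl | hQ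
    · intro v hv hx
      simp only [← hψ] at hx ⊢
      exact exists_mem_of_absolute (hM ψ (by simp)) (hM _ (by simp)) (fun i => ⟨v i, hv i⟩) hx
    · exact hΦ M (fun φ hφ => hM φ (by simp [hφ])) Q hQ

/-! ### Codes of numbers -/

theorem natCode_mem_natCode {m n : ℕ} (h : m < n) : natCode.{u} m ∈ natCode.{u} n := by
  induction n with
  | zero => omega
  | succ n ih =>
    rw [natCode, ZFSet.mem_insert_iff]
    rcases Nat.lt_succ_iff_lt_or_eq.1 h with h | rfl
    · exact Or.inr (ih h)
    · exact Or.inl rfl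

theorem natCode_injective : Function.Injective natCode.{u} := by
  intro m n h
  rcases lt_trichotomy m n with hlt | rfl | hlt
  · exact absurd (h ▸ natCode_mem_natCode hlt) (ZFSet.mem_irrefl _)
  · rfl
  · exact absurd (h ▸ natCode_mem_natCode hlt) (ZFSet.mem_irrefl _)

theorem intCode_injective : Function.Injective intCode.{u} := by
  intro m n h
  obtain ⟨h₁, h₂⟩ := ZFSet.pair_inj.1 h
  have := natCode_injective h₁
  have := natCode_injective h₂
  omega

theorem ratCode_injective : Function.Injective ratCode.{u} := by
  intro p q h
  obtain ⟨h₁, h₂⟩ := ZFSet.pair_inj.1 h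
  exact Rat.ext (intCode_injective h₁) (natCode_injective h₂)

theorem ratCode_mem_realCode {q : ℚ} {r : ℝ} : ratCode.{u} q ∈ realCode.{u} r ↔ (q : ℝ) < r := by
  rw [realCode, ZFSet.mem_range]
  refine ⟨?_, fun h => ⟨⟨q, h⟩, rfl⟩⟩
  rintro ⟨⟨p, hp⟩, h⟩
  rwa [← ratCode_injective h]

theorem realCode_injective : Function.Injective realCode.{u} := by
  intro r s h
  have key (q : ℚ) : (q : ℝ) < r ↔ (q : ℝ) < s := by
    rw [← ratCode_mem_realCode.{u}, h, ratCode_mem_realCode]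
  by_contra hne
  rcases lt_or_gt_of_ne hne with hlt | hlt
  · obtain ⟨q, h₁, h₂⟩ := exists_rat_btwn hlt
    exact lt_asymm h₁ ((key q).2 h₂)
  · obtain ⟨q, h₁, h₂⟩ := exists_rat_btwn hlt
    exact lt_asymm h₁ ((key q).1 h₂)

theorem complexCode_injective : Function.Injective complexCode.{u} := by
  intro z w h
  obtain ⟨h₁, h₂⟩ := ZFSet.pair_inj.1 h
  exact Complex.ext (realCode_injective h₁) (realCode_injective h₂)

/-! ### Codes of neighbourhoods -/

/-- The set of natural numbers. -/
noncomputable def omegaCode : ZFSet.{u} := ZFSet.range natCode.{u}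

/-- The set of reals smaller than `1 / (n + 1)`. -/
noncomputable def smallCode (n : ℕ) : ZFSet.{u} :=
  ZFSet.range fun r : {r : ℝ // r < 1 / (n + 1)} => realCode r.1

/-- The family of all sets `smallCode n`. -/
noncomputable def smallFamilyCode : ZFSet.{u} := ZFSet.range smallCode.{u}

/-- The interval with midpoint `q` and radius `1 / (n + 1)`. -/
noncomputable def intervalCode (n : ℕ) (q : ℚ) : ZFSet.{u} :=
  ZFSet.range fun r : {r : ℝ // |r - q| < 1 / (n + 1)} => realCode r.1

/-- The square with midpoint `p + q * I` and sides of length `2 / (n + 1)`. -/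
noncomputable def squareCode (n : ℕ) (p q : ℚ) : ZFSet.{u} :=
  ZFSet.range fun z : {z : ℂ // |z.re - p| < 1 / (n + 1) ∧ |z.im - q| < 1 / (n + 1)} =>
    complexCode z.1

theorem realCode_mem_smallCode {r : ℝ} {n : ℕ} :
    realCode.{u} r ∈ smallCode.{u} n ↔ r < 1 / (n + 1) := by
  rw [smallCode, ZFSet.mem_range]
  refine ⟨?_, fun h => ⟨⟨r, h⟩, rfl⟩⟩
  rintro ⟨⟨p, hp⟩, h⟩
  rwa [← realCode_injective h]

theorem realCode_mem_intervalCode {r : ℝ} {n : ℕ} {q : ℚ} :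
    realCode.{u} r ∈ intervalCode.{u} n q ↔ |r - q| < 1 / (n + 1) := by
  rw [intervalCode, ZFSet.mem_range]
  refine ⟨?_, fun h => ⟨⟨r, h⟩, rfl⟩⟩
  rintro ⟨⟨p, hp⟩, h⟩
  rwa [← realCode_injective h]

theorem complexCode_mem_squareCode {z : ℂ} {n : ℕ} {p q : ℚ} :
    complexCode.{u} z ∈ squareCode.{u} n p q ↔
      |z.re - p| < 1 / (n + 1) ∧ |z.im - q| < 1 / (n + 1) := by
  rw [squareCode, ZFSet.mem_range]
  refine ⟨?_, fun h => ⟨⟨z, h⟩, rfl⟩⟩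
  rintro ⟨⟨p, hp⟩, h⟩
  rwa [← complexCode_injective h]

/-- The parameters which the models are required to contain. -/
def baseParams : Set ZFSet.{u} :=
  {∅, omegaCode, smallFamilyCode} ∪ Set.range natCode ∪ Set.range smallCode ∪
    Set.range (fun p : ℕ × ℚ => intervalCode p.1 p.2) ∪
    Set.range (fun p : ℕ × ℚ × ℚ => squareCode p.1 p.2.1 p.2.2)

theorem countable_baseParams : baseParams.{u}.Countable := by
  refine ((((Set.Finite.countable ?_).union ?_).union ?_).union ?_).union ?_
  · exact Set.toFinite _
  all_goals exact Set.countable_range _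

theorem norm_le_abs_re_add_abs_im {𝕜 : Type*} [RCLike 𝕜] (z : 𝕜) :
    ‖z‖ ≤ |RCLike.re z| + |RCLike.im z| := by
  have hI : ‖(RCLike.I : 𝕜)‖ ≤ 1 := by
    rw [RCLike.norm_I]
    split_ifs <;> norm_num
  calc ‖z‖ = ‖(RCLike.re z : 𝕜) + RCLike.im z * RCLike.I‖ := by rw [RCLike.re_add_im]
    _ ≤ ‖(RCLike.re z : 𝕜)‖ + ‖(RCLike.im z : 𝕜) * RCLike.I‖ := norm_add_le _ _
    _ ≤ |RCLike.re z| + |RCLike.im z| := by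
      rw [norm_mul, RCLike.norm_ofReal, RCLike.norm_ofReal]
      exact add_le_add le_rfl (mul_le_of_le_one_right (abs_nonneg _) hI)

/-- Every scalar has arbitrarily small neighbourhoods whose codes are in `baseParams`. -/
theorem exists_scalar_neighbourhood {𝕜 : Type} [RCLike 𝕜] (z : 𝕜) (n : ℕ) :
    ∃ W ∈ baseParams.{u}, scalarCode.{u} z ∈ W ∧
      ∀ w : 𝕜, scalarCode.{u} w ∈ W → ‖w - z‖ ≤ 4 / (n + 1) := by
  have hpos : (0 : ℝ) < 1 / (n + 1) := by positivity
  have approx (r : ℝ) : ∃ q : ℚ, |r - q| < 1 / (n + 1) := exists_rat_near r hpos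
  obtain ⟨p, hp⟩ := approx (RCLike.re z)
  obtain ⟨q, hq⟩ := approx (RCLike.im z)
  have tri {a b c : ℝ} (h₁ : |a - c| < 1 / (n + 1)) (h₂ : |b - c| < 1 / (n + 1)) :
      |b - a| ≤ 2 / (n + 1) := by
    have : (2 : ℝ) / (n + 1) = 1 / (n + 1) + 1 / (n + 1) := by ring
    rw [this]
    rw [abs_lt] at h₁ h₂
    rw [abs_le]
    constructor <;> linarith [h₁.1, h₁.2, h₂.1, h₂.2]
  -- Real and imaginary parts each contribute at most `2 / (n + 1)`; over the reals the second
  -- summand is mere slack.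
  have h4 : (4 : ℝ) / (n + 1) = 2 / (n + 1) + 2 / (n + 1) := by ring
  have h2 : (0 : ℝ) ≤ 2 / (n + 1) := by positivity
  by_cases hI : (RCLike.I : 𝕜) = 0
  · refine ⟨intervalCode n p, Or.inl (Or.inr ⟨(n, p), rfl⟩), ?_, fun w hw => ?_⟩
    · simpa only [scalarCode, hI, if_true, realCode_mem_intervalCode] using hp
    · simp only [scalarCode, hI, if_true, realCode_mem_intervalCode] at hw
      refine (norm_le_abs_re_add_abs_im _).trans ?_
      rw [RCLike.im_eq_zero hI, abs_zero, map_sub, h4]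
      exact add_le_add (tri hp hw) h2
  · refine ⟨squareCode n p q, Or.inr ⟨(n, p, q), rfl⟩, ?_, fun w hw => ?_⟩
    · simpa only [scalarCode, hI, if_false, complexCode_mem_squareCode] using ⟨hp, hq⟩
    · simp only [scalarCode, hI, if_false, complexCode_mem_squareCode] at hw
      refine (norm_le_abs_re_add_abs_im _).trans ?_
      rw [map_sub, map_sub, h4]
      exact add_le_add (tri hp hw.1) (tri hq hw.2)

end SetModel

/-! ### Closed midpoint-convex sets and weak cluster points -/

/-- If the point with parameter `t` were missing from `s`, take the nearest parameters `a < t < b`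
on either side whose points lie in `s`. The midpoint of `a` and `b` is again such a parameter, and
it is nearer to `t` on its side. -/
theorem convex_of_isClosed_of_midpoint_mem {E : Type*} [NormedAddCommGroup E] [NormedSpace ℝ E]
    {s : Set E} (hs : IsClosed s) (hmid : ∀ x ∈ s, ∀ y ∈ s, midpoint ℝ x y ∈ s) :
    Convex ℝ s := by
  intro x hx y hy
  rw [← segment_subset_iff, segment_eq_image_lineMap]
  rintro _ ⟨t, ht, rfl⟩
  by_contra hts
  let T : Set ℝ := AffineMap.lineMap x y ⁻¹' s
  have hT : IsClosed T := hs.preimage AffineMap.lineMap_continuous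
  have hTmid {a b : ℝ} (ha : a ∈ T) (hb : b ∈ T) : midpoint ℝ a b ∈ T := by
    have := hmid _ ha _ hb
    rwa [← AffineMap.map_midpoint] at this
  obtain ⟨a, ⟨haT, ha⟩, hamax⟩ := (isCompact_Icc (a := (0 : ℝ)) (b := t)).inter_left hT
    |>.exists_isGreatest ⟨0, by simpa [T] using hx, le_rfl, ht.1⟩
  obtain ⟨b, ⟨hbT, hb⟩, hbmin⟩ := (isCompact_Icc (a := t) (b := (1 : ℝ))).inter_left hT
    |>.exists_isLeast ⟨1, by simpa [T] using hy, ht.2, le_rfl⟩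
  have hat : a < t := lt_of_le_of_ne ha.2 fun h => hts (h ▸ haT)
  have htb : t < b := lt_of_le_of_ne hb.1 fun h => hts (h ▸ hbT)
  have hc := hTmid haT hbT
  have hceq : midpoint ℝ a b = (a + b) / 2 := by
    rw [midpoint_eq_smul_add, smul_eq_mul, invOf_eq_inv]
    ring
  rw [hceq] at hc
  rcases le_total ((a + b) / 2) t with h | h
  · have := hamax ⟨hc, by linarith [ha.1], h⟩
    linarith
  · have := hbmin ⟨hc, h, by linarith [hb.2]⟩
    linarith

/-- Midpoints pass to the norm closure, which is therefore convex, and closed convex sets are weakly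
closed. Writing the midpoint condition with addition alone makes it easy to verify for `X ∩ M`. -/
theorem mem_closure_of_toWeakSpace_mem_closure {𝕜 E : Type*} [RCLike 𝕜] [NormedAddCommGroup E]
    [NormedSpace 𝕜 E] {A : Set E} (hmid : ∀ x ∈ A, ∀ y ∈ A, ∃ z ∈ A, z + z = x + y) {y : E}
    (hy : toWeakSpace 𝕜 E y ∈ closure (toWeakSpace 𝕜 E '' A)) : y ∈ closure A := by
  let _ : NormedSpace ℝ E := NormedSpace.restrictScalars ℝ 𝕜 E
  have : IsScalarTower ℝ 𝕜 E := RestrictScalars.isScalarTower ℝ 𝕜 E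
  have hconv : Convex ℝ (closure A) := by
    refine convex_of_isClosed_of_midpoint_mem isClosed_closure fun x hx y hy => ?_
    have hcont : Continuous fun p : E × E => midpoint ℝ p.1 p.2 := by
      simp only [midpoint_eq_smul_add]
      fun_prop
    refine map_mem_closure₂ hcont hx hy fun a ha b hb => ?_
    obtain ⟨z, hz, hzab⟩ := hmid a ha b hb
    have : midpoint ℝ a b = z := by
      rw [midpoint_eq_smul_add, ← hzab, ← two_smul ℝ z, smul_smul, invOf_mul_self, one_smul]
    rwa [this]
  have h := closure_mono (Set.image_mono (subset_closure (s := A))) hy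
  rw [← hconv.toWeakSpace_closure 𝕜, closure_closure] at h
  exact (toWeakSpace 𝕜 E).injective.mem_set_image.1 h

theorem norm_sub_le_of_mem_weak_closure {𝕜 E : Type*} [RCLike 𝕜] [NormedAddCommGroup E]
    [NormedSpace 𝕜 E] {B : Set E} {f : StrongDual 𝕜 E} {c : 𝕜} {δ : ℝ}
    (hB : ∀ z ∈ B, ‖f z - c‖ ≤ δ) {y : E}
    (hy : toWeakSpace 𝕜 E y ∈ closure (toWeakSpace 𝕜 E '' B)) : ‖f y - c‖ ≤ δ := by
  have hcont : Continuous fun z : WeakSpace 𝕜 E => f ((toWeakSpace 𝕜 E).symm z) :=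
    WeakBilin.eval_continuous _ f
  have hmaps : Set.MapsTo (fun z : WeakSpace 𝕜 E => f ((toWeakSpace 𝕜 E).symm z))
      (toWeakSpace 𝕜 E '' B) (Metric.closedBall c δ) := by
    rintro _ ⟨z, hz, rfl⟩
    simpa only [LinearEquiv.symm_apply_apply, mem_closedBall_iff_norm] using hB z hz
  have h := map_mem_closure hcont hy hmaps
  rwa [Metric.isClosed_closedBall.closure_eq, LinearEquiv.symm_apply_apply,
    mem_closedBall_iff_norm] at h

/-- If a point of `φ s` can be approximated, with respect to finitely many functionals from `D`, by
points of `A` in values of `φ` close to `s`, then some point of the closure of `A` is not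
distinguished from it by `D`. -/
theorem IsUscK.exists_mem_closure {𝕜 S E : Type*} [RCLike 𝕜] [MetricSpace S]
    [NormedAddCommGroup E] [NormedSpace 𝕜 E] {φ : S → Set E} (hφ : IsUscK 𝕜 φ)
    {A : Set E} (hmid : ∀ x ∈ A, ∀ y ∈ A, ∃ z ∈ A, z + z = x + y)
    {D : Set (StrongDual 𝕜 E)} {s : S} {x : E}
    (happrox : ∀ (F : Finset D) (n : ℕ), ∃ y ∈ A, ∃ t, dist t s ≤ 4 / (n + 1) ∧ y ∈ φ t ∧
      ∀ f ∈ F, ‖f.1 y - f.1 x‖ ≤ 4 / (n + 1)) :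
    ∃ y ∈ closure A, ∀ f ∈ D, f y = f x := by
  classical
  let B : Finset D × ℕ → Set E := fun i => {y | y ∈ A ∧ (∃ t, dist t s ≤ 4 / (i.2 + 1) ∧ y ∈ φ t) ∧
    ∀ f ∈ i.1, ‖f.1 y - f.1 x‖ ≤ 4 / (i.2 + 1)}
  have hB (F G : Finset D) (m n : ℕ) (hFG : F ⊆ G) (hmn : m ≤ n) : B (G, n) ⊆ B (F, m) := by
    have hle : (4 : ℝ) / (n + 1) ≤ 4 / (m + 1) := by gcongr
    rintro y ⟨hyA, ⟨t, ht, hyt⟩, hf⟩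
    exact ⟨hyA, ⟨t, ht.trans hle, hyt⟩, fun f hfF => (hf f (hFG hfF)).trans hle⟩
  have hne : (toWeakSpace 𝕜 E '' φ s ∩ ⋂ i, closure (toWeakSpace 𝕜 E '' B i)).Nonempty := by
    rw [Set.nonempty_iff_ne_empty]
    intro hempty
    -- By compactness and directedness, a single weak closure already misses `φ s`. Its complement
    -- is weakly open and contains `φ s`, hence contains `φ t` for all `t` near `s`, contradicting
    -- the approximation.
    obtain ⟨⟨F, n⟩, hi⟩ := (hφ.isCompact s).elim_directed_family_closed _
      (fun i => isClosed_closure) hempty (by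
        rintro ⟨F, m⟩ ⟨G, n⟩
        exact ⟨(F ∪ G, max m n),
          closure_mono (Set.image_mono (hB _ _ _ _ Finset.subset_union_left (le_max_left _ _))),
          closure_mono (Set.image_mono (hB _ _ _ _ Finset.subset_union_right (le_max_right _ _)))⟩)
    have hopen := hφ.isOpen (closure (toWeakSpace 𝕜 E '' B (F, n)))ᶜ isClosed_closure.isOpen_compl
    have hs : s ∈ {s | toWeakSpace 𝕜 E '' φ s ⊆ (closure (toWeakSpace 𝕜 E '' B (F, n)))ᶜ} :=
      fun z hz hz' => Set.eq_empty_iff_forall_notMem.1 hi z ⟨hz, hz'⟩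
    obtain ⟨ε, hε, hball⟩ := Metric.isOpen_iff.1 hopen s hs
    obtain ⟨k, hk⟩ := exists_nat_one_div_lt (show 0 < ε / 4 by positivity)
    obtain ⟨y, hyA, t, ht, hyt, hf⟩ := happrox F (max n k)
    have hlt : dist t s < ε := by
      refine ht.trans_lt ?_
      have h1 : (4 : ℝ) / ((max n k : ℕ) + 1) ≤ 4 / (k + 1) := by
        gcongr
        exact le_max_right _ _
      have h2 : (4 : ℝ) / (k + 1) = 4 * (1 / (k + 1)) := by ring
      linarith
    refine hball hlt (Set.mem_image_of_mem _ hyt) (subset_closure (Set.mem_image_of_mem _ ?_))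
    exact hB F F n (max n k) subset_rfl (le_max_left _ _) ⟨hyA, ⟨t, ht, hyt⟩, hf⟩
  obtain ⟨_, ⟨y, -, rfl⟩, hy⟩ := hne
  rw [Set.mem_iInter] at hy
  -- Any index places `y` in the weak closure of `A`; the indices `({f}, n)` force `f y = f x`.
  refine ⟨y, mem_closure_of_toWeakSpace_mem_closure (𝕜 := 𝕜) hmid
    (closure_mono (Set.image_mono fun z hz => hz.1) (hy (∅, 0))), fun f hf => ?_⟩
  have hle (n : ℕ) : ‖f y - f x‖ ≤ 4 * (1 / ((n : ℝ) + 1)) := by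
    rw [mul_one_div]
    exact norm_sub_le_of_mem_weak_closure (fun z hz => hz.2.2 ⟨f, hf⟩ (Finset.mem_singleton_self _))
      (hy ({⟨f, hf⟩}, n))
  have hlim : Filter.Tendsto (fun n : ℕ => 4 * (1 / ((n : ℝ) + 1))) Filter.atTop (nhds 0) := by
    simpa using tendsto_one_div_add_atTop_nhds_zero_nat.const_mul (4 : ℝ)
  exact sub_eq_zero.1 (norm_le_zero_iff.1 (ge_of_tendsto' hlim hle))

namespace SetModel

/-! ### Closure properties of elementary models -/

/-- The relations for which the models have to contain witnesses: the set arising by inserting an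
element, the two components of a pair, the values of a relation, midpoints, countable dense sets,
and points of a multimap in a prescribed neighbourhood. -/
def witnessRelations : List ((ℕ → ZFSet.{u}) → Prop) :=
  [fun v => v 0 = insert (v 1) (v 2),
   fun v => ∃ c, v 1 = ZFSet.pair (v 0) c,
   fun v => ∃ c, v 1 = ZFSet.pair c (v 0),
   fun v => ZFSet.pair (v 1) (v 0) ∈ v 2,
   -- With `v 3` the graph of addition, this reads `v 0 + v 0 = v 1 + v 2`; no code of the scalar
   -- `1/2` is needed.
   fun v => ∃ c, ZFSet.pair (ZFSet.pair (v 1) (v 2)) c ∈ v 3 ∧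
     ZFSet.pair (ZFSet.pair (v 0) (v 0)) c ∈ v 3,
   fun v => (∀ n a b, ZFSet.pair n a ∈ v 0 → ZFSet.pair n b ∈ v 0 → a = b) ∧
     ∀ s V, s ∈ v 1 → V ∈ v 4 → ∃ n t r, n ∈ v 3 ∧ ZFSet.pair n t ∈ v 0 ∧ r ∈ V ∧
       ZFSet.pair (ZFSet.pair t s) r ∈ v 2,
   fun v => ∃ s r K, (r ∈ v 3 ∧ ZFSet.pair (ZFSet.pair (v 2) s) r ∈ v 1) ∧
     (ZFSet.pair s K ∈ v 4 ∧ v 0 ∈ K) ∧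
     ∀ z, z ∈ v 5 → ∃ f W r, z = ZFSet.pair f W ∧ r ∈ W ∧ ZFSet.pair (v 0) r ∈ f]

open IsExpressible in
theorem isExpressible_of_mem_witnessRelations :
    ∀ P ∈ witnessRelations.{u}, IsExpressible P := by
  simp only [witnessRelations, List.forall_mem_cons, List.not_mem_nil, false_imp_iff, forall_const,
    and_true]
  refine ⟨eq_insert _ _ _, ex (eq_pair _ _ _), ex (eq_pair _ _ _), pair_mem _ _ _,
    ex (and (triple_mem _ _ _ _) (triple_mem _ _ _ _)), and ?_ ?_, ?_⟩
  · exact all (all (all (imp (pair_mem _ _ _) (imp (pair_mem _ _ _) (eq _ _)))))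
  · exact all (all (imp (mem _ _) (imp (mem _ _) (ex (ex (ex (and (mem _ _)
      (and (pair_mem _ _ _) (and (mem _ _) (triple_mem _ _ _ _))))))))))
  · exact ex (ex (ex (and (and (mem _ _) (triple_mem _ _ _ _)) (and (and (pair_mem _ _ _)
      (mem _ _)) (all (imp (mem _ _) (ex (ex (ex (and (eq_pair _ _ _)
        (and (mem _ _) (pair_mem _ _ _))))))))))))

/-- The assignment with values `l`, continued by `∅`. -/
def listVal (l : List ZFSet.{u}) : ℕ → ZFSet.{u} := fun n => l.getD n ∅

/-- An assignment must give every variable a value in `M`; those beyond the list receive `∅`. -/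
theorem HasWitnesses.exists_mem {M : Set ZFSet.{u}} {P : (ℕ → ZFSet.{u}) → Prop}
    (h : HasWitnesses M P) (hempty : ∅ ∈ M) (l : List ZFSet.{u}) (hl : ∀ a ∈ l, a ∈ M)
    (hx : ∃ x, P (consVal x (listVal l))) : ∃ x ∈ M, P (consVal x (listVal l)) := by
  refine h _ (fun i => ?_) hx
  rw [listVal, List.getD_eq_getElem?_getD]
  rcases lt_or_ge i l.length with hi | hi
  · simpa [hi] using hl _ (List.getElem_mem hi)
  · simpa [hi] using hempty

/-- The closure properties of elementary models used below. -/
structure IsRich (M : Set ZFSet.{u}) : Prop where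
  base : baseParams ⊆ M
  insert_mem {a b : ZFSet.{u}} : a ∈ M → b ∈ M → (insert a b : ZFSet.{u}) ∈ M
  fst_mem {a b : ZFSet.{u}} : ZFSet.pair a b ∈ M → a ∈ M
  snd_mem {a b : ZFSet.{u}} : ZFSet.pair a b ∈ M → b ∈ M
  exists_value {n f : ZFSet.{u}} : n ∈ M → f ∈ M → (∃ t, ZFSet.pair n t ∈ f) →
    ∃ t ∈ M, ZFSet.pair n t ∈ f
  exists_half {a b p : ZFSet.{u}} : a ∈ M → b ∈ M → p ∈ M →
    (∃ z c, ZFSet.pair (ZFSet.pair a b) c ∈ p ∧ ZFSet.pair (ZFSet.pair z z) c ∈ p) →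
    ∃ z ∈ M, ∃ c, ZFSet.pair (ZFSet.pair a b) c ∈ p ∧ ZFSet.pair (ZFSet.pair z z) c ∈ p
  exists_dense {S d : ZFSet.{u}} : S ∈ M → d ∈ M →
    (∃ f : ZFSet.{u}, (∀ n a b, ZFSet.pair n a ∈ f → ZFSet.pair n b ∈ f → a = b) ∧
      ∀ s V : ZFSet.{u}, s ∈ S → V ∈ smallFamilyCode → ∃ n t r : ZFSet.{u}, n ∈ omegaCode ∧ ZFSet.pair n t ∈ f ∧ r ∈ V ∧
        ZFSet.pair (ZFSet.pair t s) r ∈ d) →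
    ∃ f ∈ M, (∀ n a b, ZFSet.pair n a ∈ f → ZFSet.pair n b ∈ f → a = b) ∧
      ∀ s V : ZFSet.{u}, s ∈ S → V ∈ smallFamilyCode → ∃ n t r : ZFSet.{u}, n ∈ omegaCode ∧ ZFSet.pair n t ∈ f ∧ r ∈ V ∧
        ZFSet.pair (ZFSet.pair t s) r ∈ d
  exists_point {d t V m F : ZFSet.{u}} : d ∈ M → t ∈ M → V ∈ M → m ∈ M → F ∈ M →
    (∃ y s r K : ZFSet.{u}, (r ∈ V ∧ ZFSet.pair (ZFSet.pair t s) r ∈ d) ∧ (ZFSet.pair s K ∈ m ∧ y ∈ K) ∧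
      ∀ z, z ∈ F → ∃ f W r : ZFSet.{u}, z = ZFSet.pair f W ∧ r ∈ W ∧ ZFSet.pair y r ∈ f) →
    ∃ y ∈ M, ∃ s r K : ZFSet.{u}, (r ∈ V ∧ ZFSet.pair (ZFSet.pair t s) r ∈ d) ∧ (ZFSet.pair s K ∈ m ∧ y ∈ K) ∧
      ∀ z, z ∈ F → ∃ f W r : ZFSet.{u}, z = ZFSet.pair f W ∧ r ∈ W ∧ ZFSet.pair y r ∈ f

theorem isRich_of_hasWitnesses {M : Set ZFSet.{u}} (hbase : baseParams ⊆ M)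
    (h : ∀ P ∈ witnessRelations.{u}, HasWitnesses M P) : IsRich M := by
  have hempty : (∅ : ZFSet.{u}) ∈ M := hbase (by simp [baseParams])
  have homega : omegaCode.{u} ∈ M := hbase (by simp [baseParams])
  have hsmall : smallFamilyCode.{u} ∈ M := hbase (by simp [baseParams])
  simp only [witnessRelations, List.forall_mem_cons, List.not_mem_nil, false_imp_iff, forall_const,
    and_true] at h
  obtain ⟨h₁, h₂, h₃, h₄, h₅, h₆, h₇⟩ := h
  exact
    { base := hbase
      insert_mem {a b} ha hb := by
        obtain ⟨x, hx, hxab⟩ := h₁.exists_mem hempty [a, b] (by simp [ha, hb]) ⟨insert a b, rfl⟩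
        exact (show x = insert a b from hxab) ▸ hx
      fst_mem {a b} hp := by
        obtain ⟨x, hx, c, hc⟩ := h₂.exists_mem hempty [ZFSet.pair a b] (by simp [hp]) ⟨a, b, rfl⟩
        exact (ZFSet.pair_inj.1 (show ZFSet.pair a b = ZFSet.pair x c from hc)).1 ▸ hx
      snd_mem {a b} hp := by
        obtain ⟨x, hx, c, hc⟩ := h₃.exists_mem hempty [ZFSet.pair a b] (by simp [hp]) ⟨b, a, rfl⟩
        exact (ZFSet.pair_inj.1 (show ZFSet.pair a b = ZFSet.pair c x from hc)).2 ▸ hx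
      exists_value {n f} hn hf := h₄.exists_mem hempty [n, f] (by simp [hn, hf])
      exists_half {a b p} ha hb hp := h₅.exists_mem hempty [a, b, p] (by simp [ha, hb, hp])
      exists_dense {S d} hS hd := h₆.exists_mem hempty [S, d, omegaCode, smallFamilyCode]
        (by simp [hS, hd, homega, hsmall])
      exists_point {d t V m F} hd ht hV hm hF := h₇.exists_mem hempty [d, t, V, m, F]
        (by simp [hd, ht, hV, hm, hF]) }

namespace IsRich

variable {M : Set ZFSet.{u}}

theorem empty_mem (hM : IsRich M) : ∅ ∈ M := hM.base (by simp [baseParams])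

theorem natCode_mem (hM : IsRich M) (n : ℕ) : natCode n ∈ M :=
  hM.base (Or.inl (Or.inl (Or.inl (Or.inr ⟨n, rfl⟩))))

theorem smallCode_mem (hM : IsRich M) (n : ℕ) : smallCode n ∈ M :=
  hM.base (Or.inl (Or.inl (Or.inr ⟨n, rfl⟩)))

theorem pair_mem (hM : IsRich M) {a b : ZFSet.{u}} (ha : a ∈ M) (hb : b ∈ M) :
    ZFSet.pair a b ∈ M := by
  have single {c : ZFSet.{u}} (hc : c ∈ M) : {c} ∈ M := by
    have := hM.insert_mem hc hM.empty_mem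
    rwa [insert_empty_eq] at this
  exact hM.insert_mem (single ha) (single (hM.insert_mem ha (single hb)))

/-- Finite families of elements of `M` are in `M`. -/
theorem exists_finset_code (hM : IsRich M) {ι : Type*} (F : Finset ι) (c : ι → ZFSet.{u})
    (hc : ∀ i, c i ∈ M) : ∃ A ∈ M, ∀ z, z ∈ A ↔ ∃ i ∈ F, c i = z := by
  classical
  induction F using Finset.induction_on with
  | empty => exact ⟨∅, hM.empty_mem, by simp⟩
  | insert i F _ ih =>
    obtain ⟨A, hA, h⟩ := ih
    refine ⟨insert (c i) A, hM.insert_mem (hc i) hA, fun z => ?_⟩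
    rw [ZFSet.mem_insert_iff, h, Finset.exists_mem_insert, eq_comm]

end IsRich

/-! ### Graphs -/

theorem pair_mem_graphCode {α β : Type*} [Small.{u} α] {i : α → ZFSet.{u}} {j : β → ZFSet.{u}}
    (hi : Function.Injective i) {f : α → β} {a : α} {z : ZFSet.{u}} :
    ZFSet.pair (i a) z ∈ graphCode i j f ↔ z = j (f a) := by
  rw [graphCode, ZFSet.mem_range]
  constructor
  · rintro ⟨b, hb⟩
    obtain ⟨h₁, h₂⟩ := ZFSet.pair_inj.1 hb
    rw [← h₂, hi h₁]
  · rintro rfl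
    exact ⟨a, rfl⟩

theorem exists_of_mem_graphCode {α β : Type*} [Small.{u} α] {i : α → ZFSet.{u}}
    {j : β → ZFSet.{u}} {f : α → β} {y z : ZFSet.{u}} (h : ZFSet.pair y z ∈ graphCode i j f) :
    ∃ a, y = i a ∧ z = j (f a) := by
  rw [graphCode, ZFSet.mem_range] at h
  obtain ⟨b, hb⟩ := h
  obtain ⟨h₁, h₂⟩ := ZFSet.pair_inj.1 hb
  exact ⟨b, h₁.symm, h₂.symm⟩

theorem pairCode_injective (X Y : ZFSet.{u}) :
    Function.Injective fun p : X × Y => ZFSet.pair (p.1 : ZFSet.{u}) p.2 := by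
  intro p q h
  obtain ⟨h₁, h₂⟩ := ZFSet.pair_inj.1 h
  exact Prod.ext (Subtype.ext h₁) (Subtype.ext h₂)

theorem coe_mem_subsetCode {X : ZFSet.{u}} {A : Set X} {x : X} :
    (x : ZFSet.{u}) ∈ subsetCode A ↔ x ∈ A := by
  rw [subsetCode, ZFSet.mem_range]
  refine ⟨?_, fun h => ⟨⟨x, h⟩, rfl⟩⟩
  rintro ⟨⟨y, hy⟩, h⟩
  rwa [← Subtype.ext h]

theorem exists_of_mem_subsetCode {X : ZFSet.{u}} {A : Set X} {z : ZFSet.{u}}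
    (h : z ∈ subsetCode A) : ∃ x ∈ A, (x : ZFSet.{u}) = z := by
  rw [subsetCode, ZFSet.mem_range] at h
  obtain ⟨y, hy⟩ := h
  exact ⟨y.1, y.2, hy⟩

/-! ### The trace of a model on a space -/

namespace IsRich

variable {M : Set ZFSet.{u}}

theorem exists_half_mem_trace (hM : IsRich M) {𝕜 : Type} [RCLike 𝕜] {X : ZFSet.{u}}
    [NormedAddCommGroup X] [NormedSpace 𝕜 X] (hX : normedSpaceCode 𝕜 X ∈ M) :
    ∀ x ∈ trace X M, ∀ y ∈ trace X M, ∃ z ∈ trace X M, z + z = x + y := by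
  intro x hx y hy
  have hadd := hM.fst_mem (hM.snd_mem hX)
  have graph (a b : X) (c : ZFSet.{u}) := pair_mem_graphCode (pairCode_injective X X)
    (j := fun x : X => (x : ZFSet.{u})) (f := fun p : X × X => p.1 + p.2) (a := (a, b)) (z := c)
  have hhalf : (2⁻¹ : 𝕜) • (x + y) + (2⁻¹ : 𝕜) • (x + y) = x + y := by
    rw [← two_smul 𝕜, smul_smul, mul_inv_cancel₀ two_ne_zero, one_smul]
  obtain ⟨z, hz, c, hc, hzc⟩ := hM.exists_half hx hy hadd
    ⟨((2⁻¹ : 𝕜) • (x + y) : X), (x + y : X), (graph _ _ _).2 rfl,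
      (graph _ _ _).2 (congrArg Subtype.val hhalf.symm)⟩
  obtain ⟨⟨a, b⟩, hab, hcab⟩ := exists_of_mem_graphCode hzc
  obtain ⟨rfl, hb⟩ := ZFSet.pair_inj.1 hab
  obtain rfl : a = b := Subtype.ext hb
  exact ⟨a, hz, Subtype.ext (hcab.symm.trans ((graph _ _ _).1 hc))⟩

/-- A dense sequence is a function on the natural numbers, so `M` contains one. Every natural number
is in `M`, hence so are all terms of that sequence. -/
theorem exists_dist_lt (hM : IsRich M) {S : ZFSet.{u}} [MetricSpace S]
    [TopologicalSpace.SeparableSpace S] (hS : metricSpaceCode S ∈ M) (s : S) (n : ℕ) :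
    ∃ t ∈ trace S M, dist t s < 1 / (n + 1) := by
  have : Nonempty S := ⟨s⟩
  have graph (a b : S) (c : ZFSet.{u}) := pair_mem_graphCode (pairCode_injective S S)
    (j := realCode.{u}) (f := fun p : S × S => dist p.1 p.2) (a := (a, b)) (z := c)
  obtain ⟨f, hf, hfun, hdense⟩ := hM.exists_dense (hM.fst_mem hS) (hM.snd_mem hS) (by
    let D := TopologicalSpace.denseSeq S
    refine ⟨ZFSet.range fun k : ℕ => ZFSet.pair (natCode k) (D k), ?_, ?_⟩
    · simp only [ZFSet.mem_range]
      rintro n a b ⟨k, hk⟩ ⟨l, hl⟩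
      obtain ⟨h₁, rfl⟩ := ZFSet.pair_inj.1 hk
      obtain ⟨h₂, rfl⟩ := ZFSet.pair_inj.1 hl
      rw [natCode_injective (h₁.trans h₂.symm)]
    · intro s V hs hV
      obtain ⟨m, rfl⟩ := ZFSet.mem_range.1 hV
      obtain ⟨k, hk⟩ := (TopologicalSpace.denseRange_denseSeq S).exists_dist_lt ⟨s, hs⟩
        (show (0 : ℝ) < 1 / (m + 1) by positivity)
      rw [dist_comm] at hk
      exact ⟨natCode k, D k, realCode (dist (D k) ⟨s, hs⟩), ZFSet.mem_range.2 ⟨k, rfl⟩,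
        ZFSet.mem_range.2 ⟨k, rfl⟩, realCode_mem_smallCode.2 hk, (graph (D k) ⟨s, hs⟩ _).2 rfl⟩)
  obtain ⟨k, t, r, hk, hkt, hr, htr⟩ := hdense s (smallCode n) s.2 (ZFSet.mem_range.2 ⟨n, rfl⟩)
  obtain ⟨k, rfl⟩ := ZFSet.mem_range.1 hk
  -- The value found in `M` is the original `t` because the relation `f` is single-valued.
  obtain ⟨t', ht', hkt'⟩ := hM.exists_value (hM.natCode_mem k) hf ⟨t, hkt⟩
  obtain rfl := hfun _ _ _ hkt hkt'
  obtain ⟨⟨a, b⟩, hab, rfl⟩ := exists_of_mem_graphCode htr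
  obtain ⟨rfl, hb⟩ := ZFSet.pair_inj.1 hab
  obtain rfl : s = b := Subtype.ext hb
  exact ⟨a, ht', realCode_mem_smallCode.1 hr⟩

/-- The formula mentions only a nearby `t ∈ S ∩ M` and neighbourhoods of the scalars `f x`, all in
`M`. Its truth is witnessed by `x` and `s`; absoluteness replaces `x` by a point of `M`, while the
accompanying `s'` may lie outside `M`. -/
theorem exists_approx (hM : IsRich M) {𝕜 : Type} [RCLike 𝕜] {X : ZFSet.{u}}
    [NormedAddCommGroup X] [NormedSpace 𝕜 X] {S : ZFSet.{u}} [MetricSpace S]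
    [TopologicalSpace.SeparableSpace S] {φ : S → Set X} (hS : metricSpaceCode S ∈ M)
    (hφ : multimapCode φ ∈ M) {s : S} {x : X} (hx : x ∈ φ s) (F : Finset (dualTrace 𝕜 X M))
    (n : ℕ) : ∃ y ∈ trace X M, ∃ t, dist t s ≤ 4 / (n + 1) ∧ y ∈ φ t ∧
      ∀ f ∈ F, ‖f.1 y - f.1 x‖ ≤ 4 / (n + 1) := by
  have graph (a b : S) (c : ZFSet.{u}) := pair_mem_graphCode (pairCode_injective S S)
    (j := realCode.{u}) (f := fun p : S × S => dist p.1 p.2) (a := (a, b)) (z := c)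
  obtain ⟨t, ht, hts⟩ := hM.exists_dist_lt hS s n
  choose W hW hxW hWsmall using fun f : dualTrace 𝕜 X M =>
    exists_scalar_neighbourhood.{u} (f.1 x) n
  obtain ⟨A, hA, hAF⟩ := hM.exists_finset_code F
    (fun f => ZFSet.pair (functionalCode f.1) (W f)) fun f => hM.pair_mem f.2 (hM.base (hW f))
  obtain ⟨y, hy, s', r, K, ⟨hr, hts'⟩, ⟨hK, hyK⟩, hyA⟩ := hM.exists_point (hM.snd_mem hS) ht
    (hM.smallCode_mem n) hφ hA
    ⟨x, s, realCode (dist t s), subsetCode (φ s),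
      ⟨realCode_mem_smallCode.2 hts, (graph _ _ _).2 rfl⟩,
      ⟨(pair_mem_graphCode Subtype.val_injective).2 rfl, coe_mem_subsetCode.2 hx⟩, by
        intro z hz
        obtain ⟨f, -, rfl⟩ := (hAF z).1 hz
        exact ⟨_, _, scalarCode (f.1 x), rfl, hxW f,
          (pair_mem_graphCode Subtype.val_injective).2 rfl⟩⟩
  obtain ⟨s', rfl, rfl⟩ := exists_of_mem_graphCode hK
  obtain ⟨y, hys', rfl⟩ := exists_of_mem_subsetCode hyK
  obtain rfl := (graph t s' r).1 hts'
  refine ⟨y, hy, s', ?_, hys', fun f hf => ?_⟩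
  -- Both `s` and `s'` are within `1 / (n + 1)` of `t`; the constant 4 is needed only for the scalar
  -- estimate.
  · have h₁ := realCode_mem_smallCode.1 hr
    have h₂ := dist_triangle_left s' s t
    have h₃ : (4 : ℝ) / (n + 1) = 4 * (1 / (n + 1)) := by ring
    have h₄ : (0 : ℝ) < 1 / (n + 1) := by positivity
    linarith
  · obtain ⟨g, V, r, hgV, hrV, hyr⟩ := hyA _ ((hAF _).2 ⟨f, hf, rfl⟩)
    obtain ⟨rfl, rfl⟩ := ZFSet.pair_inj.1 hgV
    obtain rfl := (pair_mem_graphCode Subtype.val_injective).1 hyr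
    exact hWsmall f _ hrV

end IsRich

end SetModel

theorem propositionP :
    ∃ (Φ : List (SetModel.setLang.Formula ℕ)) (Y : Set ZFSet.{u}), Y.Countable ∧
      ∀ M : Set ZFSet.{u}, SetModel.IsElementaryModel Φ Y M →
        ∀ (𝕜 : Type) [RCLike 𝕜]
          (X : ZFSet.{u}) [NormedAddCommGroup X] [NormedSpace 𝕜 X] [CompleteSpace X]
          (S : ZFSet.{u}) [MetricSpace S] [TopologicalSpace.SeparableSpace S]
          (φ : S → Set X), IsUscK 𝕜 φ → (⋃ s, φ s) = Set.univ →
          SetModel.normedSpaceCode 𝕜 X ∈ M →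
          SetModel.metricSpaceCode S ∈ M →
          SetModel.multimapCode φ ∈ M →
          closure (SetModel.trace X M) + preAnnihilator (SetModel.dualTrace 𝕜 X M) =
            Set.univ := by
  obtain ⟨Φ, hΦ⟩ := SetModel.exists_list_hasWitnesses SetModel.witnessRelations.{u}
    SetModel.isExpressible_of_mem_witnessRelations
  refine ⟨Φ, SetModel.baseParams, SetModel.countable_baseParams, ?_⟩
  intro M hM 𝕜 _ X _ _ _ S _ _ φ hφ honto hX hS hφM
  have hrich := SetModel.isRich_of_hasWitnesses hM.subset (hΦ M hM.absolute)
  refine Set.eq_univ_of_forall fun x => ?_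
  obtain ⟨s, hs⟩ := Set.mem_iUnion.1 (honto ▸ Set.mem_univ x : x ∈ ⋃ s, φ s)
  obtain ⟨y, hy, hyx⟩ := hφ.exists_mem_closure (hrich.exists_half_mem_trace hX)
    (hrich.exists_approx (𝕜 := 𝕜) hS hφM hs)
  refine Set.mem_add.2 ⟨y, hy, x - y, fun f hf => ?_, add_sub_cancel y x⟩
  rw [map_sub, hyx f hf, sub_self]
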